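/- Let $q$ be a nonzero complex number with $q^m\neq 1$ for all integers $m\ge 1$, let $n\ge 1$, $N=2n+1$, and let $c\in\mathbb C$ be such that $c^2$ is a nonzero real number. For $1\le i\le N$ put $i'=N+1-i$, and let $\rho_i=\tfrac N2-i$ if $i<i'$, $\rho_i=-(\tfrac N2-i')$ if $i'<i$, and $\rho_i=0$ if $i=i'$. With $i,j,k,l\in\{1,\dots,N\}$, with $\delta_{i<l}=1$ if $i<l$ and $0$ otherwise, and with the Kronecker symbol $\delta$, set $$C^{ij}=C_{ij}=q^{-2\rho_i}\delta_{i j'},\qquad K^{ij}_{kl}=C^{ij}C_{kl},$$ $$\hat R^{ij}_{kl}=q^{2\delta_{ij}-2\delta_{ij'}}\delta_{il}\delta_{jk}+(q^2-q^{-2})\,\delta_{i<l}\,(\delta_{ik}\delta_{jl}-K^{ij}_{kl}),$$ $$P_+=\frac1{q^2+q^{-2}}\Bigl(q^{-2}\,\mathrm{id}+\hat R-\frac{(q+q^{-1})(q-q^{-1})}{q^{2N}-1}K\Bigr).$$ Let $\mathrm{Cl}_q(N)$ be the unital associative complex algebra generated by $\gamma_1,\dots,\gamma_N$ with the relations $$\sum_{k,l}(P_+)^{kl}_{ij}\gamma_k\gamma_l=0\quad(1\le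 i,j\le N),\qquad \sum_{i,j}C^{ij}\gamma_i\gamma_j=c^2\,\frac{q^{2N}-1}{q^2-1},$$ and let $\mathcal I_+$ and $\mathcal I_-$ be the two-sided ideals of $\mathrm{Cl}_q(N)$ generated by $$\rho_+=\gamma_1\cdots\gamma_n(c+\gamma_{n+1})\gamma_{n+2}\cdots\gamma_N,\qquad \rho_-=\gamma_1\cdots\gamma_n(-c+\gamma_{n+1})\gamma_{n+2}\cdots\gamma_N,$$ respectively. Then the algebra $\mathrm{Cl}_q(2n+1)$ is finite-dimensional and semisimple, and $\mathrm{Cl}_q(2n+1)=\mathcal I_+\oplus\mathcal I_-$, where $\mathcal I_+$ and $\mathcal I_-$ are simple ideals: each is a minimal nonzero two-sided ideal of $\mathrm{Cl}_q(2n+1)$ and is simple as a ring. Moreover $\dim_{\mathbb C}\mathcal I_+=\dim_{\mathbb C}\mathcal I_-$. -/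

import Mathlib

/-! Throughout, indices are `0`-based: the index `i ∈ {1, …, N}` is the element `i - 1` of `Fin N`,
and `i' = N + 1 - i` is `Fin.rev i`. -/

namespace FRTClifford

noncomputable section

/-- `2 ρ_i`, an integer, where `ρ_i = N/2 - i` if `i < i'`, `ρ_i = -(N/2 - i')` if `i' < i`,
and `ρ_i = 0` if `i = i'`. -/
def twoRho (N : ℕ) (i : Fin N) : ℤ :=
  if i < i.rev then (N : ℤ) - 2 * ((i : ℤ) + 1)
  else if i.rev < i then -((N : ℤ) - 2 * ((i.rev : ℤ) + 1))
  else 0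

/-- The metric `C^{ij} = C_{ij} = q^{-2 ρ_i} δ_{i j'}`. -/
def metric (N : ℕ) (q : ℂ) (i j : Fin N) : ℂ :=
  if i = j.rev then q ^ (-twoRho N i) else 0

/-- The matrix `K^{ij}_{kl} = C^{ij} C_{kl}`; upper indices label rows, lower ones columns. -/
def matK (N : ℕ) (q : ℂ) : Matrix (Fin N × Fin N) (Fin N × Fin N) ℂ :=
  fun a b => metric N q a.1 a.2 * metric N q b.1 b.2

/-- The `R`-matrix
`R^{ij}_{kl} = q^{2 δ_{ij} - 2 δ_{ij'}} δ_{il} δ_{jk}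
  + (q² - q⁻²) δ_{i<l} (δ_{ik} δ_{jl} - K^{ij}_{kl})`. -/
def matR (N : ℕ) (q : ℂ) : Matrix (Fin N × Fin N) (Fin N × Fin N) ℂ :=
  fun a b =>
    q ^ ((if a.1 = a.2 then 2 else 0) - (if a.1 = a.2.rev then 2 else 0) : ℤ)
        * (if a.1 = b.2 then 1 else 0) * (if a.2 = b.1 then 1 else 0)
      + (q ^ 2 - q⁻¹ ^ 2) * (if a.1 < b.2 then 1 else 0)
        * ((if a.1 = b.1 then 1 else 0) * (if a.2 = b.2 then 1 else 0) - matK N q a b)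

/-- `P_+ = (q² + q⁻²)⁻¹ (q⁻² id + R - (q + q⁻¹)(q - q⁻¹) / (q^{2N} - 1) K)`. -/
def projPlus (N : ℕ) (q : ℂ) : Matrix (Fin N × Fin N) (Fin N × Fin N) ℂ :=
  (q ^ 2 + q⁻¹ ^ 2)⁻¹ •
    (q⁻¹ ^ 2 • (1 : Matrix (Fin N × Fin N) (Fin N × Fin N) ℂ) + matR N q
      - ((q + q⁻¹) * (q - q⁻¹) / (q ^ (2 * N) - 1)) • matK N q)

/-- The defining relations of the quantum Clifford algebra. -/
inductive Rel (N : ℕ) (q c : ℂ) : FreeAlgebra ℂ (Fin N) → FreeAlgebra ℂ (Fin N) → Prop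
  | proj (i j : Fin N) :
      Rel N q c
        (∑ k, ∑ l, projPlus N q (k, l) (i, j) • (FreeAlgebra.ι ℂ k * FreeAlgebra.ι ℂ l)) 0
  | norm :
      Rel N q c
        (∑ i, ∑ j, metric N q i j • (FreeAlgebra.ι ℂ i * FreeAlgebra.ι ℂ j))
        (algebraMap ℂ (FreeAlgebra ℂ (Fin N)) (c ^ 2 * ((q ^ (2 * N) - 1) / (q ^ 2 - 1))))

/-- The quantum Clifford algebra `Cl_q(N)` with parameter `c²`. -/
abbrev Cl (N : ℕ) (q c : ℂ) : Type := RingQuot (Rel N q c)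

/-- The generators `γ_i` of `Cl_q(N)`. -/
def gen {N : ℕ} (q c : ℂ) (i : Fin N) : Cl N q c :=
  RingQuot.mkAlgHom ℂ (Rel N q c) (FreeAlgebra.ι ℂ i)

/-- The element `γ_1 ⋯ γ_n (s + γ_{n+1}) γ_{n+2} ⋯ γ_{2n+1}` of `Cl_q(2n+1)`. -/
def rho (n : ℕ) (q c s : ℂ) : Cl (2 * n + 1) q c :=
  (List.ofFn fun i : Fin n => gen q c (⟨i, by omega⟩ : Fin (2 * n + 1))).prod
    * (algebraMap ℂ (Cl (2 * n + 1) q c) s + gen q c (⟨n, by omega⟩ : Fin (2 * n + 1)))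
    * (List.ofFn fun i : Fin n => gen q c (⟨n + 1 + i, by omega⟩ : Fin (2 * n + 1))).prod

/-- The two-sided ideal `I_+` generated by `ρ_+`. -/
def idealPlus (n : ℕ) (q c : ℂ) : TwoSidedIdeal (Cl (2 * n + 1) q c) :=
  TwoSidedIdeal.span {rho n q c c}

/-- The two-sided ideal `I_-` generated by `ρ_-`. -/
def idealMinus (n : ℕ) (q c : ℂ) : TwoSidedIdeal (Cl (2 * n + 1) q c) :=
  TwoSidedIdeal.span {rho n q c (-c)}

/-- The complex vector space underlying a two-sided ideal of a complex algebra. -/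
def toSubspace {A : Type*} [Ring A] [Algebra ℂ A] (I : TwoSidedIdeal A) : Submodule ℂ A :=
  (TwoSidedIdeal.asIdeal I).restrictScalars ℂ

/-- A two-sided ideal is simple if it is nonzero, contains no two-sided ideal of the ambient ring
other than `0` and itself, and is simple as a (non-unital) ring. -/
def IsSimpleIdeal {A : Type*} [Ring A] (I : TwoSidedIdeal A) : Prop :=
  IsAtom I ∧ IsSimpleRing I

end

end FRTClifford

/-! The algebra is built up two generators at a time: `Cl (N + 2)` is the algebra of 2 × 2 matrices
over `Cl N`. Put `z = c² / (q² - 1)`. Using the norm relation, the `K`-term of `P_+` becomes a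
multiple of `z`, and the relations make sense for any element `z` (`IsQClifford`). In this form they
peel (`isQClifford_peel`): the first and last generators square to zero, have anticommutator a
nonzero multiple of `z`, and q-anticommute with the inner generators. The inner ones satisfy the
same relations with `z` replaced by `z' = z + q⁻ᴺ γ_first γ_last`.

When `z` is a scalar, the outer generators are, after rescaling, matrix units `a = E₁₂` and `b =
E₂₁`, but `z'` is no longer a scalar. Multiplying the inner generators by `u = ba - q⁻² ab` repairs
this: `u² z' = z`, and the products commute with `a` and `b` (`exists_twist`). Hence
`exists_algEquiv_matrix`.

The induction starts from `Cl 1 = ℂ[γ] / (γ² - c²) ≅ ℂ × ℂ`, where `ρ_±` are nonzero elements of the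
two factors. Each step sends `ρ_s` to a nonzero multiple of the previous `ρ_s` in one matrix corner
(`map_rho_succ`), so the two elements stay in separate factors. Thus `Cl (2n+1) ≅ R × R` with `R`
simple and finite-dimensional, and `ρ_±` generate the two factors. -/

namespace FRTClifford

/-! ### Ideals in a product of two simple algebras -/

section SimpleFactors

variable {A R S : Type*} [Ring A] [Algebra ℂ A] [Ring R] [Algebra ℂ R] [Ring S] [Algebra ℂ S]

/-- The embedding of the first factor of a product decomposition of an algebra. -/
def inlHom (φ : A ≃ₐ[ℂ] R × S) : R →ₙ+* A where
  toFun r := φ.symm (r, 0)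
  map_mul' r s := by rw [← map_mul, Prod.mk_mul_mk, mul_zero]
  map_zero' := map_zero φ.symm
  map_add' r s := by rw [← map_add, Prod.mk_add_mk, add_zero]

lemma inlHom_apply (φ : A ≃ₐ[ℂ] R × S) (r : R) : inlHom φ r = φ.symm (r, 0) := rfl

lemma inlHom_fst (φ : A ≃ₐ[ℂ] R × S) {a : A} (ha : (φ a).2 = 0) : inlHom φ (φ a).1 = a := by
  rw [inlHom_apply, ← ha, Prod.mk.eta, φ.symm_apply_apply]

/-- A nonzero element of a simple factor generates that factor as a two-sided ideal. -/
lemma mem_span_singleton_iff_snd_eq_zero [IsSimpleRing R] (φ : A ≃ₐ[ℂ] R × S) {x : A}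
    (h1 : (φ x).1 ≠ 0) (h2 : (φ x).2 = 0) (a : A) :
    a ∈ TwoSidedIdeal.span {x} ↔ (φ a).2 = 0 := by
  constructor
  · intro ha
    have hle : TwoSidedIdeal.span {x} ≤
        TwoSidedIdeal.ker ((RingHom.snd R S).comp (φ : A →+* R × S)) := by
      rw [TwoSidedIdeal.span_le, Set.singleton_subset_iff]
      exact (TwoSidedIdeal.mem_ker _).2 h2
    exact (TwoSidedIdeal.mem_ker _).1 (hle ha)
  · intro ha
    -- The ideal is pulled back to `R`, where simplicity forces it to be everything.
    have hx : (φ x).1 ∈ (TwoSidedIdeal.span {x}).comap (inlHom φ) := by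
      rw [TwoSidedIdeal.mem_comap, inlHom_fst φ h2]
      exact TwoSidedIdeal.subset_span rfl
    have htop : (TwoSidedIdeal.span {x}).comap (inlHom φ) = ⊤ :=
      (TwoSidedIdeal.one_mem_iff _).1 (IsSimpleRing.one_mem_of_ne_zero_mem _ h1 hx)
    have ha' : (φ a).1 ∈ (TwoSidedIdeal.span {x}).comap (inlHom φ) := by
      rw [htop]; exact TwoSidedIdeal.mem_top _
    rwa [TwoSidedIdeal.mem_comap, inlHom_fst φ ha] at ha'

/-- Membership in the span depends only on the factor, not on the generator, so any nonzero element
of a smaller ideal already generates the whole one. -/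
lemma isAtom_span_singleton [IsSimpleRing R] (φ : A ≃ₐ[ℂ] R × S) {x : A}
    (h1 : (φ x).1 ≠ 0) (h2 : (φ x).2 = 0) : IsAtom (TwoSidedIdeal.span {x}) := by
  constructor
  · intro h
    have hx : x ∈ TwoSidedIdeal.span {x} := TwoSidedIdeal.subset_span rfl
    rw [h, TwoSidedIdeal.mem_bot] at hx
    exact h1 (by rw [hx, map_zero]; rfl)
  · intro J hJ
    by_contra hne
    obtain ⟨y, hyJ, hy0⟩ := SetLike.exists_of_lt (bot_lt_iff_ne_bot.2 hne)
    rw [TwoSidedIdeal.mem_bot] at hy0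
    have hy2 : (φ y).2 = 0 := (mem_span_singleton_iff_snd_eq_zero φ h1 h2 y).1 (hJ.le hyJ)
    have hy1 : (φ y).1 ≠ 0 := fun h ↦ hy0 <| φ.injective <| by
      rw [map_zero]; exact Prod.ext h hy2
    refine hJ.not_ge fun a ha ↦ ?_
    rw [mem_span_singleton_iff_snd_eq_zero φ h1 h2,
      ← mem_span_singleton_iff_snd_eq_zero φ hy1 hy2] at ha
    exact TwoSidedIdeal.span_le.2 (Set.singleton_subset_iff.2 hyJ) ha

lemma isSimpleIdeal_span_singleton [IsSimpleRing R] (φ : A ≃ₐ[ℂ] R × S) {x : A}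
    (h1 : (φ x).1 ≠ 0) (h2 : (φ x).2 = 0) : IsSimpleIdeal (TwoSidedIdeal.span {x}) := by
  refine ⟨isAtom_span_singleton φ h1 h2, ?_⟩
  have hmem := mem_span_singleton_iff_snd_eq_zero φ h1 h2
  let e : R ≃+* TwoSidedIdeal.span {x} :=
    { toFun r := ⟨inlHom φ r, (hmem _).2 (by simp [inlHom_apply])⟩
      invFun a := (φ a.1).1
      left_inv r := by simp [inlHom_apply]
      right_inv a := Subtype.ext (inlHom_fst φ ((hmem _).1 a.2))
      map_mul' r s := Subtype.ext (map_mul (inlHom φ) r s)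
      map_add' r s := Subtype.ext (map_add (inlHom φ) r s) }
  exact IsSimpleRing.of_ringEquiv e inferInstance

lemma mem_toSubspace (I : TwoSidedIdeal A) (a : A) : a ∈ toSubspace I ↔ a ∈ I := by
  simp [toSubspace]

lemma finrank_span_singleton [IsSimpleRing R] (φ : A ≃ₐ[ℂ] R × S) {x : A}
    (h1 : (φ x).1 ≠ 0) (h2 : (φ x).2 = 0) :
    Module.finrank ℂ (toSubspace (TwoSidedIdeal.span {x})) = Module.finrank ℂ R := by
  have hmem := mem_span_singleton_iff_snd_eq_zero φ h1 h2
  refine LinearEquiv.finrank_eq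
    { toFun a := (φ a.1).1
      invFun r := ⟨inlHom φ r, (mem_toSubspace _ _).2 ((hmem _).2 (by simp [inlHom_apply]))⟩
      left_inv a := Subtype.ext (inlHom_fst φ ((hmem _).1 ((mem_toSubspace _ _).1 a.2)))
      right_inv r := by simp [inlHom_apply]
      map_add' a b := by simp
      map_smul' t a := by simp }

lemma isCompl_span_singleton [IsSimpleRing R] [IsSimpleRing S] (φ : A ≃ₐ[ℂ] R × S) {x y : A}
    (hx1 : (φ x).1 ≠ 0) (hx2 : (φ x).2 = 0) (hy1 : (φ y).1 = 0) (hy2 : (φ y).2 ≠ 0) :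
    IsCompl (toSubspace (TwoSidedIdeal.span {x})) (toSubspace (TwoSidedIdeal.span {y})) := by
  have hx := mem_span_singleton_iff_snd_eq_zero φ hx1 hx2
  have hy : ∀ a, a ∈ TwoSidedIdeal.span {y} ↔ (φ a).1 = 0 :=
    -- The two factors are swapped so that the same lemma covers the second one.
    mem_span_singleton_iff_snd_eq_zero (φ.trans (AlgEquiv.ofRingEquiv (f := RingEquiv.prodComm) fun _ ↦ rfl)) hy2 hy1
  constructor
  · rw [Submodule.disjoint_def]
    intro a ha hb
    rw [mem_toSubspace] at ha hb
    refine φ.injective ?_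
    rw [map_zero]
    exact Prod.ext ((hy a).1 hb) ((hx a).1 ha)
  · rw [codisjoint_iff, Submodule.eq_top_iff']
    intro a
    refine Submodule.mem_sup.2 ⟨φ.symm ((φ a).1, 0), ?_, φ.symm (0, (φ a).2), ?_, ?_⟩
    · rw [mem_toSubspace, hx]; simp
    · rw [mem_toSubspace, hy]; simp
    · rw [← map_add]; simp

end SimpleFactors

/-! ### Rewriting the defining relations -/

section Relations

variable {N : ℕ} {A : Type*} [Ring A] [Algebra ℂ A]

/-- The partial sum `z + ∑_{i < l} C^{ii'} g_i g_{i'}`. -/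
noncomputable def partialNorm (q : ℂ) (z : A) (g : Fin N → A) (l : Fin N) : A :=
  z + ∑ i, if i < l then metric N q i i.rev • (g i * g i.rev) else 0

/-- The relation in column `(k, l)` of `P_+`, with the full norm eliminated in favour of `z`. -/
noncomputable def colRel (q : ℂ) (z : A) (g : Fin N → A) (k l : Fin N) : A :=
  q⁻¹ ^ 2 • (g k * g l)
    + q ^ ((if l = k then 2 else 0) - (if l = k.rev then 2 else 0) : ℤ) • (g l * g k)
    + (q ^ 2 - q⁻¹ ^ 2) • ((if k < l then g k * g l else 0)
      - metric N q k l • partialNorm q z g l)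

/-- A family satisfying the relations of the quantum Clifford algebra, where the element `z`
replaces the scalar `c² / (q² - 1)`. -/
structure IsQClifford (q : ℂ) (z : A) (g : Fin N → A) : Prop where
  col (k l : Fin N) : colRel q z g k l = 0
  norm : ∑ i, metric N q i i.rev • (g i * g i.rev) = (q ^ (2 * N) - 1) • z

lemma metric_eq_ite (q : ℂ) (i j : Fin N) :
    metric N q i j = if j = i.rev then metric N q i i.rev else 0 := by
  by_cases h : j = i.rev
  · simp [h]
  · have : i ≠ j.rev := fun h' ↦ h (by rw [h', Fin.rev_rev])
    simp [metric, h, this]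

lemma sum_metric_row_smul (q : ℂ) (i : Fin N) (x : Fin N → A) :
    ∑ j, metric N q i j • x j = metric N q i i.rev • x i.rev := by
  rw [Finset.sum_eq_single i.rev]
  · intro j _ hj
    rw [metric_eq_ite, if_neg hj, zero_smul]
  · simp

lemma sum_metric_smul (q : ℂ) (g : Fin N → A) :
    ∑ i, ∑ j, metric N q i j • (g i * g j) = ∑ i, metric N q i i.rev • (g i * g i.rev) := by
  exact Finset.sum_congr rfl fun i _ ↦ sum_metric_row_smul q i _

lemma sum_one_smul (g : Fin N → A) (i j : Fin N) :
    ∑ k, ∑ l, (1 : Matrix (Fin N × Fin N) (Fin N × Fin N) ℂ) (k, l) (i, j) • (g k * g l)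
      = g i * g j := by
  simp_rw [Matrix.one_apply, Prod.mk.injEq, ite_and, ite_smul, zero_smul, one_smul]
  simp

lemma sum_matK_smul (q : ℂ) (g : Fin N → A) (i j : Fin N) :
    ∑ k, ∑ l, matK N q (k, l) (i, j) • (g k * g l)
      = metric N q i j • ∑ k, metric N q k k.rev • (g k * g k.rev) := by
  simp_rw [← sum_metric_smul, Finset.smul_sum, smul_smul, matK, mul_comm]

lemma sum_matR_smul (q : ℂ) (g : Fin N → A) (i j : Fin N) :
    ∑ k, ∑ l, matR N q (k, l) (i, j) • (g k * g l)
      = q ^ ((if j = i then 2 else 0) - (if j = i.rev then 2 else 0) : ℤ) • (g j * g i)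
        + (q ^ 2 - q⁻¹ ^ 2) • ((if i < j then g i * g j else 0)
          - metric N q i j • ∑ k, if k < j then metric N q k k.rev • (g k * g k.rev) else 0) := by
  -- Kronecker deltas become nested conditionals so that each sum collapses separately; the exponent
  -- is then abstracted to keep its own conditions out of the case split.
  have h1 : ∀ k l, matR N q (k, l) (i, j) • (g k * g l) =
      (if k = j then if l = i then
        q ^ ((if k = l then 2 else 0) - (if k = l.rev then 2 else 0) : ℤ) • (g k * g l)
        else 0 else 0)
      + (q ^ 2 - q⁻¹ ^ 2) • ((if k = i then if l = j then
          (if k < j then g k * g l else 0) else 0 else 0)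
        - metric N q i j • if k < j then metric N q k l • (g k * g l) else 0) := by
    intro k l
    dsimp only [matR, matK]
    generalize q ^ ((if k = l then 2 else 0) - (if k = l.rev then 2 else 0) : ℤ) = e
    split_ifs <;> module
  simp_rw [h1, Finset.sum_add_distrib, ← Finset.smul_sum, Finset.sum_sub_distrib,
    ← Finset.smul_sum]
  congr 1
  · simp
  · congr 2
    · simp
    · congr 1
      refine Finset.sum_congr rfl fun k _ ↦ ?_
      split_ifs
      · exact sum_metric_row_smul q k _
      · simp

lemma sum_projPlus_smul (q : ℂ) (g : Fin N → A) (i j : Fin N) :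
    ∑ k, ∑ l, projPlus N q (k, l) (i, j) • (g k * g l)
      = (q ^ 2 + q⁻¹ ^ 2)⁻¹ • (q⁻¹ ^ 2 • (g i * g j)
        + (∑ k, ∑ l, matR N q (k, l) (i, j) • (g k * g l))
        - ((q + q⁻¹) * (q - q⁻¹) / (q ^ (2 * N) - 1)) •
          ∑ k, ∑ l, matK N q (k, l) (i, j) • (g k * g l)) := by
  simp_rw [projPlus, Matrix.smul_apply, Matrix.sub_apply, Matrix.add_apply, Matrix.smul_apply,
    smul_eq_mul, mul_smul, sub_smul, add_smul, mul_smul, ← Finset.smul_sum,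
    Finset.sum_sub_distrib, Finset.sum_add_distrib, ← Finset.smul_sum, sum_one_smul]

/-- The defining relations of `Cl_q(N)` in terms of `IsQClifford`. -/
lemma isQClifford_iff (q c : ℂ) (hq0 : q ≠ 0) (hq : ∀ m : ℕ, 1 ≤ m → q ^ m ≠ 1) (hN : 1 ≤ N)
    (g : Fin N → A) :
    IsQClifford q (algebraMap ℂ A (c ^ 2 / (q ^ 2 - 1))) g ↔
      (∀ i j, ∑ k, ∑ l, projPlus N q (k, l) (i, j) • (g k * g l) = 0) ∧
      ∑ i, ∑ j, metric N q i j • (g i * g j)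
        = algebraMap ℂ A (c ^ 2 * ((q ^ (2 * N) - 1) / (q ^ 2 - 1))) := by
  have hN1 : q ^ (2 * N) - 1 ≠ 0 := sub_ne_zero.2 (hq _ (by omega))
  have h21 : q ^ 2 - 1 ≠ 0 := sub_ne_zero.2 (hq _ (by omega))
  -- Vanishing would give `q⁴ = -1`, hence `q⁸ = 1`.
  have h4 : q ^ 2 + q⁻¹ ^ 2 ≠ 0 := fun h ↦ hq 8 (by omega) <| by
    field_simp at h
    linear_combination (q ^ 4 - 1) * h
  have hz : algebraMap ℂ A (c ^ 2 * ((q ^ (2 * N) - 1) / (q ^ 2 - 1)))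
      = (q ^ (2 * N) - 1) • algebraMap ℂ A (c ^ 2 / (q ^ 2 - 1)) := by
    rw [Algebra.smul_def, ← map_mul]; congr 1; ring
  rw [sum_metric_smul, hz]
  have key : (∑ i, metric N q i i.rev • (g i * g i.rev)
        = (q ^ (2 * N) - 1) • algebraMap ℂ A (c ^ 2 / (q ^ 2 - 1))) →
      ∀ i j, (∑ k, ∑ l, projPlus N q (k, l) (i, j) • (g k * g l) = 0 ↔
        colRel q (algebraMap ℂ A (c ^ 2 / (q ^ 2 - 1))) g i j = 0) := by
    -- Since `(q + q⁻¹)(q - q⁻¹) = q² - q⁻²`, substituting the norm merges the `K`-term of `P_+`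
    -- with the one in `R`.
    intro hn i j
    rw [sum_projPlus_smul, sum_matK_smul, hn, smul_eq_zero, or_iff_right (inv_ne_zero h4),
      sum_matR_smul, colRel, partialNorm]
    refine Eq.congr_left ?_
    match_scalars <;> field_simp
    ring
  constructor
  · rintro ⟨h1, h2⟩
    exact ⟨fun i j ↦ (key h2 i j).2 (h1 i j), h2⟩
  · rintro ⟨h1, h2⟩
    exact ⟨fun i j ↦ (key h2 i j).1 (h1 i j), h2⟩

lemma IsQClifford.map {B : Type*} [Ring B] [Algebra ℂ B] {q : ℂ} {z : A} {g : Fin N → A}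
    (h : IsQClifford q z g) (f : A →ₐ[ℂ] B) : IsQClifford q (f z) (f ∘ g) := by
  constructor
  · intro k l
    rw [← map_zero f, ← h.col k l]
    simp [colRel, partialNorm, apply_ite f]
  · rw [← map_smul, ← h.norm]
    simp

/-- Rescaling by an element that commutes with the family. -/
lemma IsQClifford.mul_left {q : ℂ} {z : A} {g : Fin N → A} (h : IsQClifford q z g) (u : A)
    (hu : ∀ i, Commute u (g i)) : IsQClifford q (u * u * z) (fun i ↦ u * g i) := by
  -- Every relation is homogeneous quadratic in `g` and linear in `z`, so a common factor `u * u`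
  -- comes out.
  have hm : ∀ i j, u * g i * (u * g j) = u * u * (g i * g j) := fun i j ↦ by
    rw [mul_assoc, ← mul_assoc (g i), ← (hu i).eq]; simp only [mul_assoc]
  constructor
  · intro k l
    rw [← mul_zero (u * u), ← h.col k l]
    simp only [colRel, partialNorm, hm, mul_add, mul_sub, mul_smul_comm, Finset.mul_sum, mul_ite,
      mul_zero]
  · rw [← mul_smul_comm, ← h.norm]
    simp only [hm, mul_smul_comm, Finset.mul_sum]

end Relations

/-! ### The universal property -/

section Presentation

variable {N : ℕ} {A : Type*} [Ring A] [Algebra ℂ A]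

lemma isQClifford_gen (q c : ℂ) (hq0 : q ≠ 0) (hq : ∀ m : ℕ, 1 ≤ m → q ^ m ≠ 1) (hN : 1 ≤ N) :
    IsQClifford q (algebraMap ℂ (Cl N q c) (c ^ 2 / (q ^ 2 - 1))) (gen (N := N) q c) := by
  rw [isQClifford_iff q c hq0 hq hN]
  constructor
  · intro i j
    have h := RingQuot.mkAlgHom_rel ℂ (Rel.proj (N := N) (q := q) (c := c) i j)
    simpa only [map_sum, map_smul, map_mul, map_zero] using! h
  · have h := RingQuot.mkAlgHom_rel ℂ (Rel.norm (N := N) (q := q) (c := c))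
    simpa only [map_sum, map_smul, map_mul, AlgHom.commutes] using! h

/-- The universal property of `Cl_q(N)`. -/
noncomputable def liftCl {q c : ℂ} (hq0 : q ≠ 0) (hq : ∀ m : ℕ, 1 ≤ m → q ^ m ≠ 1) (hN : 1 ≤ N)
    {g : Fin N → A} (h : IsQClifford q (algebraMap ℂ A (c ^ 2 / (q ^ 2 - 1))) g) :
    Cl N q c →ₐ[ℂ] A :=
  RingQuot.liftAlgHom ℂ ⟨FreeAlgebra.lift ℂ g, by
    rw [isQClifford_iff q c hq0 hq hN] at h
    rintro x y (⟨i, j⟩ | _)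
    · simpa only [map_sum, map_smul, map_mul, map_zero, FreeAlgebra.lift_ι_apply] using h.1 i j
    · simpa only [map_sum, map_smul, map_mul, AlgHom.commutes, FreeAlgebra.lift_ι_apply]
        using h.2⟩

@[simp] lemma liftCl_gen {q c : ℂ} (hq0 : q ≠ 0) (hq : ∀ m : ℕ, 1 ≤ m → q ^ m ≠ 1) (hN : 1 ≤ N)
    {g : Fin N → A} (h : IsQClifford q (algebraMap ℂ A (c ^ 2 / (q ^ 2 - 1))) g) (i : Fin N) :
    liftCl hq0 hq hN h (gen q c i) = g i := by
  simp [liftCl, gen]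

lemma algHom_ext_gen {q c : ℂ} {f f' : Cl N q c →ₐ[ℂ] A}
    (h : ∀ i, f (gen q c i) = f' (gen q c i)) : f = f' := by
  apply RingQuot.ringQuot_ext'
  ext i
  exact h i

end Presentation

/-! ### Removing the first and last generators -/

section Peeling

variable {N : ℕ} {A : Type*} [Ring A] [Algebra ℂ A]

/-- The inclusion of the indices other than the first and the last one. -/
def inner (j : Fin N) : Fin (N + 2) := j.succ.castSucc

lemma rev_inner (j : Fin N) : (inner j).rev = inner j.rev := by
  ext; simp [inner, Fin.val_rev]; omega

lemma inner_lt_inner {i j : Fin N} : inner i < inner j ↔ i < j := by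
  simp [inner]

lemma inner_inj {i j : Fin N} : inner i = inner j ↔ i = j := by
  simp [inner]

lemma inner_ne_zero (j : Fin N) : inner j ≠ 0 := by
  simp [inner, Fin.ext_iff]

lemma inner_ne_last (j : Fin N) : inner j ≠ Fin.last (N + 1) := by
  simp only [inner, ne_eq, Fin.ext_iff, Fin.val_castSucc, Fin.val_succ, Fin.val_last]; omega

lemma inner_lt_last (j : Fin N) : inner j < Fin.last (N + 1) := Fin.castSucc_lt_last _

lemma zero_lt_inner (j : Fin N) : 0 < inner j := Fin.pos_of_ne_zero (inner_ne_zero j)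

lemma forall_index_iff {p : Fin (N + 2) → Prop} :
    (∀ i, p i) ↔ p 0 ∧ (∀ j, p (inner j)) ∧ p (Fin.last (N + 1)) := by
  rw [Fin.forall_fin_succ', Fin.forall_fin_succ, and_assoc]
  rfl

lemma sum_index {M : Type*} [AddCommMonoid M] (f : Fin (N + 2) → M) :
    ∑ i, f i = f 0 + ∑ j, f (inner j) + f (Fin.last (N + 1)) := by
  rw [Fin.sum_univ_castSucc, Fin.sum_univ_succ]
  rfl

/-- `N - 2i` is unchanged under `N ↦ N + 2`, `i ↦ i + 1`; this is why the inner relations are again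
those of a quantum Clifford algebra. -/
lemma twoRho_inner (j : Fin N) : twoRho (N + 2) (inner j) = twoRho N j := by
  simp only [twoRho, rev_inner, inner_lt_inner]
  have h (i : Fin N) : ((inner i : Fin (N + 2)) : ℤ) = (i : ℤ) + 1 := by simp [inner]
  rw [h, h]
  push_cast
  split_ifs <;> ring

lemma metric_inner (q : ℂ) (i j : Fin N) : metric (N + 2) q (inner i) (inner j) = metric N q i j := by
  simp only [metric, rev_inner, inner_inj, twoRho_inner]

lemma metric_zero_last (q : ℂ) : metric (N + 2) q 0 (Fin.last (N + 1)) = (q ^ N)⁻¹ := by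
  simp [metric, twoRho]

lemma metric_last_zero (q : ℂ) : metric (N + 2) q (Fin.last (N + 1)) 0 = q ^ N := by
  simp [metric, twoRho, Fin.last_pos]

lemma metric_eq_zero {q : ℂ} {i j : Fin N} (h : j ≠ i.rev) : metric N q i j = 0 := by
  rw [metric_eq_ite, if_neg h]

/-- The relations of the quantum Clifford algebra that involve the first or the last generator. -/
structure OuterRel (q : ℂ) (z : A) (g : Fin (N + 2) → A) : Prop where
  zero_sq : g 0 * g 0 = 0
  last_sq : g (Fin.last _) * g (Fin.last _) = 0
  anticomm : g 0 * g (Fin.last _) + g (Fin.last _) * g 0 = (q ^ N * (q ^ 4 - 1)) • z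
  zero_inner (j : Fin N) : q ^ 2 • (g 0 * g (inner j)) + g (inner j) * g 0 = 0
  inner_last (j : Fin N) :
    q ^ 2 • (g (inner j) * g (Fin.last _)) + g (Fin.last _) * g (inner j) = 0

/-- The element that replaces `z` once the first and the last generator are removed. -/
noncomputable def innerNorm (q : ℂ) (z : A) (g : Fin (N + 2) → A) : A :=
  z + (q ^ N)⁻¹ • (g 0 * g (Fin.last _))

variable (q : ℂ) (z : A) (g : Fin (N + 2) → A)

lemma partialNorm_zero : partialNorm q z g 0 = z := by
  simp [partialNorm]

/-- The first index always contributes and the last never does, so the outer contribution is the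
same for every `l` and can be absorbed into `z`. -/
lemma partialNorm_inner (l : Fin N) :
    partialNorm q z g (inner l) = partialNorm q (innerNorm q z g) (g ∘ inner) l := by
  simp only [partialNorm, innerNorm, sum_index, zero_lt_inner, inner_lt_inner, Fin.rev_zero,
    metric_zero_last, rev_inner, metric_inner, if_true, if_neg (inner_lt_last l).not_gt,
    Function.comp_apply]
  abel

lemma sum_metric_peel :
    ∑ i, metric (N + 2) q i i.rev • (g i * g i.rev) = (q ^ N)⁻¹ • (g 0 * g (Fin.last _))
      + ∑ i, metric N q i i.rev • ((g ∘ inner) i * (g ∘ inner) i.rev)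
      + q ^ N • (g (Fin.last _) * g 0) := by
  simp only [sum_index, Fin.rev_zero, metric_zero_last, rev_inner, metric_inner, Fin.rev_last,
    metric_last_zero, Function.comp_apply]

lemma partialNorm_last :
    partialNorm q z g (Fin.last _) = innerNorm q z g
      + ∑ i, metric N q i i.rev • ((g ∘ inner) i * (g ∘ inner) i.rev) := by
  simp only [partialNorm, innerNorm, sum_index, Fin.last_pos, inner_lt_last, Fin.rev_zero,
    metric_zero_last, rev_inner, metric_inner, if_true, lt_irrefl, if_false,
    Function.comp_apply]
  abel

lemma colRel_inner_inner (k l : Fin N) :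
    colRel q z g (inner k) (inner l) = colRel q (innerNorm q z g) (g ∘ inner) k l := by
  simp only [colRel, partialNorm_inner, inner_inj, rev_inner, metric_inner, inner_lt_inner,
    Function.comp_apply]

variable {q z g}

lemma colRel_zero_zero : colRel q z g 0 0 = (q ^ 2 + q⁻¹ ^ 2) • (g 0 * g 0) := by
  have h : (0 : Fin (N + 2)) ≠ (0 : Fin (N + 2)).rev := by simp [Fin.ext_iff]
  simp only [colRel, if_true, if_neg h, metric_eq_zero h, lt_irrefl, if_false, sub_zero]
  norm_cast
  module

lemma colRel_last_last :
    colRel q z g (Fin.last _) (Fin.last _)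
      = (q ^ 2 + q⁻¹ ^ 2) • (g (Fin.last _) * g (Fin.last _)) := by
  have h : Fin.last (N + 1) ≠ (Fin.last (N + 1)).rev := by simp [Fin.ext_iff]
  simp only [colRel, if_true, if_neg h, metric_eq_zero h, lt_irrefl, if_false, sub_zero]
  norm_cast
  module

lemma colRel_zero_inner (j : Fin N) :
    colRel q z g 0 (inner j) = q ^ 2 • (g 0 * g (inner j)) + g (inner j) * g 0 := by
  have h : inner j ≠ (0 : Fin (N + 2)).rev := by simpa using inner_ne_last j
  simp only [colRel, if_neg h, if_neg (inner_ne_zero j), metric_eq_zero h, zero_lt_inner, if_true,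
    sub_zero, zpow_zero]
  module

/-- This column repeats column `(0, inner j)` up to the factor `q⁻²`, so it adds no relation. -/
lemma colRel_inner_zero (hq0 : q ≠ 0) (j : Fin N) :
    colRel q z g (inner j) 0 = q⁻¹ ^ 2 • (q ^ 2 • (g 0 * g (inner j)) + g (inner j) * g 0) := by
  have h : 0 ≠ (inner j).rev := by rw [rev_inner]; exact (inner_ne_zero _).symm
  simp only [colRel, if_neg h, if_neg (inner_ne_zero j).symm, metric_eq_zero h, sub_zero,
    zpow_zero, if_neg (zero_lt_inner j).not_gt]
  match_scalars <;> (field_simp; try ring)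

lemma colRel_inner_last (j : Fin N) :
    colRel q z g (inner j) (Fin.last _)
      = q ^ 2 • (g (inner j) * g (Fin.last _)) + g (Fin.last _) * g (inner j) := by
  have h : Fin.last _ ≠ (inner j).rev := by rw [rev_inner]; exact (inner_ne_last _).symm
  simp only [colRel, if_neg h, if_neg (inner_ne_last j).symm, metric_eq_zero h, inner_lt_last,
    if_true, sub_zero, zpow_zero]
  module

lemma colRel_last_inner (hq0 : q ≠ 0) (j : Fin N) :
    colRel q z g (Fin.last _) (inner j)
      = q⁻¹ ^ 2 • (q ^ 2 • (g (inner j) * g (Fin.last _)) + g (Fin.last _) * g (inner j)) := by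
  have h : inner j ≠ (Fin.last (N + 1)).rev := by simpa using inner_ne_zero j
  simp only [colRel, if_neg h, if_neg (inner_ne_last j), metric_eq_zero h, sub_zero,
    zpow_zero, if_neg (inner_lt_last j).not_gt]
  match_scalars <;> (field_simp; try ring)

/-- No index precedes `0`, so the partial norm is `z` itself and the column becomes the
anticommutator relation. -/
lemma colRel_last_zero (hq0 : q ≠ 0) :
    colRel q z g (Fin.last _) 0
      = q⁻¹ ^ 2 • (g 0 * g (Fin.last _) + g (Fin.last _) * g 0
        - (q ^ N * (q ^ 4 - 1)) • z) := by
  have h : (0 : Fin (N + 2)) ≠ Fin.last (N + 1) := by simp [Fin.ext_iff]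
  simp only [colRel, Fin.rev_last, if_neg h, if_true, metric_last_zero, partialNorm_zero,
    Fin.not_lt_zero, if_false, zero_sub, zpow_neg]
  norm_cast
  match_scalars <;> (field_simp; try ring)

/-- This column is redundant: its partial norm contains the whole inner norm, which is a multiple of
`innerNorm`, and what remains is the anticommutator. -/
lemma colRel_zero_last (hq0 : q ≠ 0)
    (h1 : g 0 * g (Fin.last _) + g (Fin.last _) * g 0 = (q ^ N * (q ^ 4 - 1)) • z)
    (h2 : ∑ i, metric N q i i.rev • ((g ∘ inner) i * (g ∘ inner) i.rev)
      = (q ^ (2 * N) - 1) • innerNorm q z g) :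
    colRel q z g 0 (Fin.last _) = 0 := by
  have h : Fin.last (N + 1) ≠ (0 : Fin (N + 2)) := by simp [Fin.ext_iff]
  simp only [colRel, Fin.rev_zero, if_neg h, if_true, metric_zero_last, partialNorm_last, h2,
    Fin.last_pos, zero_sub, zpow_neg, innerNorm]
  norm_cast
  linear_combination (norm := skip) (q ^ 2)⁻¹ • h1
  match_scalars <;> (field_simp; try ring)

/-- Given the relation between the outer generators, the norm relations for a family and for its
inner part are equivalent. -/
lemma norm_peel_iff (hq0 : q ≠ 0)
    (h1 : g 0 * g (Fin.last _) + g (Fin.last _) * g 0 = (q ^ N * (q ^ 4 - 1)) • z) :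
    ∑ i, metric (N + 2) q i i.rev • (g i * g i.rev) = (q ^ (2 * (N + 2)) - 1) • z ↔
      ∑ i, metric N q i i.rev • ((g ∘ inner) i * (g ∘ inner) i.rev)
        = (q ^ (2 * N) - 1) • innerNorm q z g := by
  rw [sum_metric_peel, ← sub_eq_zero,
    ← sub_eq_zero (b := (q ^ (2 * N) - 1) • innerNorm q z g)]
  refine Eq.congr_left ?_
  simp only [innerNorm]
  linear_combination (norm := skip) q ^ N • h1
  match_scalars <;> (field_simp; try ring)

/-- The relations of the quantum Clifford algebra, peeled by one layer. -/
theorem isQClifford_peel (hq0 : q ≠ 0) (h4 : q ^ 2 + q⁻¹ ^ 2 ≠ 0) :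
    IsQClifford q z g ↔ OuterRel q z g ∧ IsQClifford q (innerNorm q z g) (g ∘ inner) := by
  have hi : q⁻¹ ^ 2 ≠ 0 := by positivity
  constructor
  · intro h
    have h1 : g 0 * g (Fin.last _) + g (Fin.last _) * g 0 = (q ^ N * (q ^ 4 - 1)) • z := by
      have := h.col (Fin.last _) 0
      rwa [colRel_last_zero hq0, smul_eq_zero, or_iff_right hi, sub_eq_zero] at this
    refine ⟨⟨?_, ?_, h1, fun j ↦ ?_, fun j ↦ ?_⟩, ⟨fun k l ↦ ?_, (norm_peel_iff hq0 h1).1 h.norm⟩⟩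
    · have := h.col 0 0
      rwa [colRel_zero_zero, smul_eq_zero, or_iff_right h4] at this
    · have := h.col (Fin.last _) (Fin.last _)
      rwa [colRel_last_last, smul_eq_zero, or_iff_right h4] at this
    · rw [← colRel_zero_inner (z := z), h.col]
    · rw [← colRel_inner_last (z := z), h.col]
    · rw [← colRel_inner_inner, h.col]
  · rintro ⟨ho, h⟩
    refine ⟨?_, (norm_peel_iff hq0 ho.anticomm).2 h.norm⟩
    simp_rw [forall_index_iff]
    refine ⟨⟨?_, fun j ↦ ?_, ?_⟩, fun i ↦ ⟨?_, fun j ↦ ?_, ?_⟩, ⟨?_, fun j ↦ ?_, ?_⟩⟩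
    · rw [colRel_zero_zero, ho.zero_sq, smul_zero]
    · rw [colRel_zero_inner, ho.zero_inner]
    · exact colRel_zero_last hq0 ho.anticomm h.norm
    · rw [colRel_inner_zero hq0, ho.zero_inner, smul_zero]
    · rw [colRel_inner_inner, h.col]
    · rw [colRel_inner_last, ho.inner_last]
    · rw [colRel_last_zero hq0, ho.anticomm, sub_self, smul_zero]
    · rw [colRel_last_inner hq0, ho.inner_last, smul_zero]
    · rw [colRel_last_last, ho.last_sq, smul_zero]

end Peeling

/-! ### The isomorphism of `Cl (N + 2)` with 2 × 2 matrices over `Cl N` -/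

section MatrixStep

open Matrix

/-- A pair of elements satisfying the relations of the matrix units `E₁₂`, `E₂₁`, together with a
homomorphism into their centralizer, gives a homomorphism from `2 × 2` matrices. -/
def matrixTwoLift {A B : Type*} [Ring A] [Algebra ℂ A] [Ring B] [Algebra ℂ B] (h : B →ₐ[ℂ] A)
    (a b : A) (ha : a * a = 0) (hb : b * b = 0) (hab : a * b + b * a = 1)
    (hca : ∀ x, h x * a = a * h x) (hcb : ∀ x, h x * b = b * h x) :
    Matrix (Fin 2) (Fin 2) B →ₐ[ℂ] A :=
  have haba : a * (b * a) = a := by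
    rw [eq_sub_of_add_eq' hab, mul_sub, ← mul_assoc, ha, zero_mul, sub_zero, mul_one]
  have hbab : b * (a * b) = b := by
    rw [eq_sub_of_add_eq hab, mul_sub, ← mul_assoc, hb, zero_mul, sub_zero, mul_one]
  AlgHom.ofLinearMap
    { toFun X := a * b * h (X 0 0) + a * h (X 0 1) + b * h (X 1 0) + b * a * h (X 1 1)
      map_add' X Y := by simp only [Matrix.add_apply, map_add, mul_add]; abel
      map_smul' t X := by simp [smul_add] }
    (by simpa using hab)
    (by
      -- These rewrite rules bring products to a normal form: a reduced word in `a` and `b`,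
      -- followed by values of `h`.
      have ha' (t : A) : a * (a * t) = 0 := by rw [← mul_assoc, ha, zero_mul]
      have hb' (t : A) : b * (b * t) = 0 := by rw [← mul_assoc, hb, zero_mul]
      have haba' (t : A) : a * (b * (a * t)) = a * t := by
        rw [← mul_assoc b, ← mul_assoc a, haba]
      have hbab' (t : A) : b * (a * (b * t)) = b * t := by
        rw [← mul_assoc a, ← mul_assoc b, hbab]
      have hca' (x : B) (t : A) : h x * (a * t) = a * (h x * t) := by
        rw [← mul_assoc, hca, mul_assoc]
      have hcb' (x : B) (t : A) : h x * (b * t) = b * (h x * t) := by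
        rw [← mul_assoc, hcb, mul_assoc]
      intro X Y
      simp only [LinearMap.coe_mk, AddHom.coe_mk, mul_apply, Fin.sum_univ_two, map_add, map_mul,
        mul_add, add_mul, mul_assoc, hca', hcb', ha', hb', haba', hbab', mul_zero]
      abel)

lemma matrixTwoLift_apply {A B : Type*} [Ring A] [Algebra ℂ A] [Ring B] [Algebra ℂ B]
    (h : B →ₐ[ℂ] A) (a b : A) (ha : a * a = 0) (hb : b * b = 0) (hab : a * b + b * a = 1)
    (hca : ∀ x, h x * a = a * h x) (hcb : ∀ x, h x * b = b * h x)
    (X : Matrix (Fin 2) (Fin 2) B) :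
    matrixTwoLift h a b ha hb hab hca hcb X
      = a * b * h (X 0 0) + a * h (X 0 1) + b * h (X 1 0) + b * a * h (X 1 1) := rfl

/-- The family with given first, inner and last members. -/
def extend {N : ℕ} {A : Type*} (a : A) (f : Fin N → A) (b : A) : Fin (N + 2) → A :=
  Fin.lastCases b (Fin.cases a f)

lemma extend_zero {N : ℕ} {A : Type*} (a : A) (f : Fin N → A) (b : A) : extend a f b 0 = a :=
  Fin.lastCases_castSucc (i := (0 : Fin (N + 1))) ..

lemma extend_inner {N : ℕ} {A : Type*} (a : A) (f : Fin N → A) (b : A) (j : Fin N) : extend a f b (inner j) = f j :=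
  Fin.lastCases_castSucc (i := j.succ) ..

lemma extend_last {N : ℕ} {A : Type*} (a : A) (f : Fin N → A) (b : A) : extend a f b (Fin.last _) = b :=
  Fin.lastCases_last ..

variable {N : ℕ} {A : Type*} [Ring A] [Algebra ℂ A]

/-- Quantum Clifford families in `2 × 2` matrices with two more generators. -/
lemma isQClifford_extend {q : ℂ} (hq0 : q ≠ 0) (h4 : q ^ 2 + q⁻¹ ^ 2 ≠ 0) {t : ℂ} {g : Fin N → A}
    (h : IsQClifford q (algebraMap ℂ A t) g) :
    IsQClifford q (algebraMap ℂ (Matrix (Fin 2) (Fin 2) A) t)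
      (extend !![0, algebraMap ℂ A (q ^ N * (q ^ 4 - 1) * t); 0, 0]
        (fun j ↦ !![-(q ^ 2) • g j, 0; 0, g j]) !![0, 0; 1, 0]) := by
  rw [isQClifford_peel hq0 h4]
  constructor
  · constructor <;> try intro j
    all_goals simp only [extend_zero, extend_last, extend_inner]
    all_goals
      ext i k
      fin_cases i <;> fin_cases k <;>
        simp [Algebra.algebraMap_eq_smul_one, smul_smul]
  -- The inner family is a scalar family times `diag(-q², 1)`, whose square `diag(q⁴, 1)` times `t`
  -- is exactly the `innerNorm` here.
  · have hD := (h.map (Matrix.scalarAlgHom (Fin 2) ℂ)).mul_left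
      (!![-(q ^ 2) • 1, 0; 0, 1]) (fun i ↦ by
        ext i k
        fin_cases i <;> fin_cases k <;> simp)
    convert hD using 1
    · simp only [innerNorm, extend_zero, extend_last]
      ext i k
      fin_cases i <;> fin_cases k <;>
        simp [Algebra.algebraMap_eq_smul_one, smul_smul]
      match_scalars
      field_simp
      ring
    · funext j
      rw [Function.comp_apply, extend_inner]
      ext i k
      fin_cases i <;> fin_cases k <;> simp

/-- Removing the outer generators from a quantum Clifford family: the inner ones, suitably twisted,
form a quantum Clifford family that commutes with the outer ones. -/
lemma exists_twist {q t : ℂ} (hq0 : q ≠ 0) (h4 : q ^ 2 + q⁻¹ ^ 2 ≠ 0)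
    (hκ : q ^ N * (q ^ 4 - 1) * t ≠ 0) {g : Fin (N + 2) → A}
    (h : IsQClifford q (algebraMap ℂ A t) g) {a b : A}
    (ha : g 0 = (q ^ N * (q ^ 4 - 1) * t) • a) (hb : g (Fin.last _) = b) :
    a * a = 0 ∧ b * b = 0 ∧ a * b + b * a = 1 ∧
      (∀ j, Commute ((b * a - q⁻¹ ^ 2 • (a * b)) * g (inner j)) a) ∧
      (∀ j, Commute ((b * a - q⁻¹ ^ 2 • (a * b)) * g (inner j)) b) ∧
      (b * a - q ^ 2 • (a * b)) * (b * a - q⁻¹ ^ 2 • (a * b)) = 1 ∧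
      IsQClifford q (algebraMap ℂ A t) (fun j ↦ (b * a - q⁻¹ ^ 2 • (a * b)) * g (inner j)) := by
  obtain ⟨ho, hi⟩ := (isQClifford_peel hq0 h4).1 h
  have haa : a * a = 0 := by
    have := ho.zero_sq
    rwa [ha, smul_mul_smul_comm, smul_eq_zero, or_iff_right (mul_ne_zero hκ hκ)] at this
  have hbb : b * b = 0 := by rw [← hb]; exact ho.last_sq
  have hab : a * b + b * a = 1 := by
    have := ho.anticomm
    rw [ha, hb, smul_mul_assoc, mul_smul_comm, ← smul_add, Algebra.algebraMap_eq_smul_one,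
      smul_smul] at this
    exact smul_right_injective A hκ this
  have hga (j : Fin N) : g (inner j) * a = -(q ^ 2) • (a * g (inner j)) := by
    have := ho.zero_inner j
    rw [ha, smul_mul_assoc, mul_smul_comm, smul_comm, ← smul_add, smul_eq_zero,
      or_iff_right hκ] at this
    rw [eq_neg_of_add_eq_zero_right this, neg_smul]
  have hgb (j : Fin N) : g (inner j) * b = -(q⁻¹ ^ 2) • (b * g (inner j)) := by
    have := ho.inner_last j
    rw [hb] at this
    rw [eq_neg_of_add_eq_zero_right this]
    match_scalars
    field_simp
  have haba : a * b * a = a := by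
    rw [mul_assoc, eq_sub_of_add_eq' hab, mul_sub, ← mul_assoc, haa, zero_mul, sub_zero, mul_one]
  have hbab : b * a * b = b := by
    rw [mul_assoc, eq_sub_of_add_eq hab, mul_sub, ← mul_assoc, hbb, zero_mul, sub_zero, mul_one]
  have hp : (b * a) * (b * a) = b * a := by rw [← mul_assoc, hbab]
  have hp' : (a * b) * (a * b) = a * b := by rw [← mul_assoc, haba]
  have hpp : (b * a) * (a * b) = 0 := by rw [mul_assoc, ← mul_assoc a, haa, zero_mul, mul_zero]
  have hpp' : (a * b) * (b * a) = 0 := by rw [mul_assoc, ← mul_assoc b, hbb, zero_mul, mul_zero]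
  -- On the complementary idempotents `ab` and `ba` the element `u` is `-q⁻²` and `1`. This ratio
  -- cancels the factors `-q²` and `-q⁻²` that appear when inner generators move past `a` and `b`.
  set u := b * a - q⁻¹ ^ 2 • (a * b) with hu
  have hua : u * a = -(q⁻¹ ^ 2) • a := by
    rw [hu, sub_mul, smul_mul_assoc, haba, mul_assoc, haa, mul_zero, zero_sub, neg_smul]
  have hau : a * u = a := by
    rw [hu, mul_sub, mul_smul_comm, ← mul_assoc, ← mul_assoc, haba, haa, zero_mul, smul_zero,
      sub_zero]
  have hub : u * b = b := by
    rw [hu, sub_mul, smul_mul_assoc, hbab, mul_assoc a, hbb, mul_zero, smul_zero, sub_zero]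
  have hbu : b * u = -(q⁻¹ ^ 2) • b := by
    rw [hu, mul_sub, mul_smul_comm, ← mul_assoc, ← mul_assoc, hbab, hbb, zero_mul, zero_sub,
      neg_smul]
  have hgu (j : Fin N) : Commute u (g (inner j)) := by
    have h1 : Commute (b * a) (g (inner j)) := by
      rw [commute_iff_eq, ← mul_assoc, hgb, smul_mul_assoc, mul_assoc b (g _), hga, mul_smul_comm,
        smul_smul, mul_assoc]
      match_scalars
      field_simp
    have h2 : Commute (a * b) (g (inner j)) := by
      rw [commute_iff_eq, ← mul_assoc, hga, smul_mul_assoc, mul_assoc a (g _), hgb, mul_smul_comm,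
        smul_smul, mul_assoc]
      match_scalars
      field_simp
    exact h1.sub_left (h2.smul_left _)
  refine ⟨haa, hbb, hab, fun j ↦ ?_, fun j ↦ ?_, ?_, ?_⟩
  · rw [commute_iff_eq, mul_assoc, hga, mul_smul_comm, ← mul_assoc, hua, ← mul_assoc, hau,
      smul_mul_assoc, smul_smul]
    match_scalars
    field_simp
  · rw [commute_iff_eq, mul_assoc, hgb, mul_smul_comm, ← mul_assoc, hub, ← mul_assoc, hbu,
      smul_mul_assoc]
  · rw [hu, ← hab]
    simp only [mul_sub, sub_mul, smul_mul_assoc, mul_smul_comm, hp, hp', hpp, hpp', smul_zero]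
    match_scalars <;> field_simp
  · have hD := hi.mul_left u hgu
    convert hD using 1
    swap
    · rfl
    -- Here `innerNorm` equals `t (ba + q⁴ ab)`, so multiplying by `u²` returns the scalar `t`.
    have huu : u * u = b * a + q⁻¹ ^ 4 • (a * b) := by
      rw [hu]
      simp only [mul_sub, sub_mul, smul_mul_assoc, mul_smul_comm, hp, hp', hpp, hpp', smul_zero]
      match_scalars <;> field_simp
    rw [huu, innerNorm, ha, hb, Algebra.algebraMap_eq_smul_one, mul_add, mul_smul_comm, mul_one]
    simp only [add_mul, smul_mul_assoc, mul_smul_comm, hp', hpp]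
    rw [← hab]
    match_scalars <;> field_simp
    ring

lemma commute_of_commute_gen {q c : ℂ} (h : Cl N q c →ₐ[ℂ] A) (y : A)
    (hy : ∀ j, Commute (h (gen q c j)) y) (x : Cl N q c) : Commute (h x) y := by
  obtain ⟨x, rfl⟩ := RingQuot.mkAlgHom_surjective ℂ _ x
  induction x using FreeAlgebra.induction with
  | grade0 r => rw [AlgHom.commutes, AlgHom.commutes]; exact Algebra.commutes r y
  | grade1 j => exact hy j
  | mul x x' h1 h2 => rw [map_mul, map_mul]; exact h1.mul_left h2
  | add x x' h1 h2 => rw [map_add, map_add]; exact h1.add_left h2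

lemma neg_smul_neg_inv_smul_one_mul {t : ℂ} (ht : t ≠ 0) (x : A) :
    -t • (-(t⁻¹ • (1 : A)) * x) = x := by
  rw [neg_mul, smul_mul_assoc, one_mul, smul_neg, neg_smul, neg_neg, smul_inv_smul₀ ht]

lemma mul_neg_smul_add (t : ℂ) (x y w : A) :
    x * (-t • w) + y * w = (y - t • x) * w := by
  rw [mul_smul_comm, sub_mul, smul_mul_assoc, neg_smul]
  abel

/-- `Cl_q(N + 2)` is isomorphic to the algebra of `2 × 2` matrices over `Cl_q(N)`. -/
theorem exists_algEquiv_matrix {q c : ℂ} (hq0 : q ≠ 0) (hq : ∀ m : ℕ, 1 ≤ m → q ^ m ≠ 1)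
    (hN : 1 ≤ N) (hc : c ≠ 0) :
    ∃ (e : Cl (N + 2) q c ≃ₐ[ℂ] Matrix (Fin 2) (Fin 2) (Cl N q c)) (κ : ℂ), κ ≠ 0 ∧
      e (gen q c 0) = !![0, algebraMap ℂ (Cl N q c) κ; 0, 0] ∧
      (∀ j, e (gen q c (inner j)) = !![-(q ^ 2) • gen q c j, 0; 0, gen q c j]) ∧
      e (gen q c (Fin.last _)) = !![0, 0; 1, 0] := by
  have h21 : q ^ 2 - 1 ≠ 0 := sub_ne_zero.2 (hq _ (by omega))
  have h41 : q ^ 4 - 1 ≠ 0 := sub_ne_zero.2 (hq _ (by omega))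
  have h4 : q ^ 2 + q⁻¹ ^ 2 ≠ 0 := fun h ↦ hq 8 (by omega) <| by
    field_simp at h
    linear_combination (q ^ 4 - 1) * h
  have hκ : q ^ N * (q ^ 4 - 1) * (c ^ 2 / (q ^ 2 - 1)) ≠ 0 := by positivity
  have hg := isQClifford_gen (N := N) q c hq0 hq hN
  have hg' := isQClifford_gen (N := N + 2) q c hq0 hq (by omega)
  let F := liftCl hq0 hq (by omega) (isQClifford_extend hq0 h4 hg)
  have hF0 := (liftCl_gen hq0 hq (by omega) (isQClifford_extend hq0 h4 hg) 0).trans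
    (extend_zero ..)
  have hFi (j : Fin N) := (liftCl_gen hq0 hq (by omega) (isQClifford_extend hq0 h4 hg)
    (inner j)).trans (extend_inner ..)
  have hFl := (liftCl_gen hq0 hq (by omega) (isQClifford_extend hq0 h4 hg) (Fin.last _)).trans
    (extend_last ..)
  change F _ = _ at hF0 hFl
  change ∀ j, F _ = _ at hFi
  set κ := q ^ N * (q ^ 4 - 1) * (c ^ 2 / (q ^ 2 - 1)) with hκdef
  -- Dividing the first generator by `κ` normalizes the anticommutator to `1`.
  obtain ⟨a, ha⟩ : ∃ a, gen (N := N + 2) q c 0 = κ • a :=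
    ⟨κ⁻¹ • gen q c 0, by rw [smul_inv_smul₀ hκ]⟩
  obtain ⟨b, hb⟩ : ∃ b, gen (N := N + 2) q c (Fin.last _) = b := ⟨_, rfl⟩
  obtain ⟨haa, hbb, hab, hca, hcb, hu, hT⟩ := exists_twist hq0 h4 hκ hg' ha hb
  set u := b * a - q⁻¹ ^ 2 • (a * b) with hudef
  clear_value u
  let h := liftCl hq0 hq hN hT
  have hh (j : Fin N) : h (gen q c j) = u * gen q c (inner j) := liftCl_gen hq0 hq hN hT j
  have hcomm (y : Cl (N + 2) q c) (hy : ∀ j, Commute (u * gen q c (inner j)) y) (x : Cl N q c) :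
      h x * y = y * h x :=
    (commute_of_commute_gen h y (fun j ↦ by rw [hh]; exact hy j) x).eq
  let G := matrixTwoLift h a b haa hbb hab (hcomm a hca) (hcomm b hcb)
  have hG := matrixTwoLift_apply h a b haa hbb hab (hcomm a hca) (hcomm b hcb)
  have hFa : F a = !![0, 1; 0, 0] := by
    refine smul_right_injective _ hκ ?_
    dsimp only
    rw [← map_smul, ← ha, hF0]
    ext i k
    fin_cases i <;> fin_cases k <;> simp [Algebra.algebraMap_eq_smul_one]
  have hFb : F b = !![0, 0; 1, 0] := by rw [← hb, hFl]
  -- `F u = diag(-q⁻², 1)` undoes the diagonal twist in the images of the inner generators.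
  have hFh : F.comp h = Matrix.scalarAlgHom (Fin 2) ℂ := by
    refine algHom_ext_gen fun j ↦ ?_
    rw [AlgHom.comp_apply, hh, hudef, map_mul, map_sub, map_smul, map_mul, map_mul, hFa, hFb, hFi]
    ext i k
    fin_cases i <;> fin_cases k <;> simp
    exact neg_smul_neg_inv_smul_one_mul (pow_ne_zero 2 hq0) _
  have hFG : F.comp G = AlgHom.id ℂ _ := by
    refine AlgHom.ext fun X ↦ ?_
    have hFh' (x) : F (h x) = Matrix.scalarAlgHom (Fin 2) ℂ x := DFunLike.congr_fun hFh x
    rw [AlgHom.comp_apply, hG]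
    simp only [map_add, map_mul, hFa, hFb, hFh']
    ext i k
    fin_cases i <;> fin_cases k <;> simp
  have hGF : G.comp F = AlgHom.id ℂ _ := by
    refine algHom_ext_gen ?_
    rw [forall_index_iff]
    refine ⟨?_, fun j ↦ ?_, ?_⟩
    · rw [AlgHom.comp_apply, hF0, hG, AlgHom.id_apply, ha]
      simp [Algebra.algebraMap_eq_smul_one]
    · rw [AlgHom.comp_apply, hFi, hG, AlgHom.id_apply]
      simp only [Matrix.of_apply, Matrix.cons_val', Matrix.cons_val_zero, Matrix.cons_val_one,
        Matrix.cons_val_fin_one, map_zero, mul_zero, add_zero, map_smul, hh]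
      -- The left factor is the inverse of `u`.
      calc _ = (b * a - q ^ 2 • (a * b)) * (u * gen q c (inner j)) := by
            exact mul_neg_smul_add _ _ _ _
        _ = _ := by rw [← mul_assoc, hu, one_mul]
    · rw [AlgHom.comp_apply, hFl, hG, AlgHom.id_apply, hb]
      simp
  exact ⟨AlgEquiv.ofAlgHom F G hFG hGF, κ, hκ, hF0, hFi, hFl⟩

end MatrixStep

/-! ### The two factors and the elements `ρ_±` -/

section Decomposition

open Matrix

lemma exists_prod_ofFn_diagonal {B : Type*} [Ring B] [Algebra ℂ B] (t : ℂ) {m : ℕ}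
    (f : Fin m → B) :
    ∃ x, (List.ofFn fun i ↦ (!![t • f i, 0; 0, f i] : Matrix (Fin 2) (Fin 2) B)).prod
      = !![x, 0; 0, (List.ofFn f).prod] := by
  induction m with
  | zero => exact ⟨1, by simp [Matrix.one_fin_two]⟩
  | succ m ih =>
    obtain ⟨x, hx⟩ := ih (fun i ↦ f i.succ)
    exact ⟨t • f 0 * x, by simp [List.ofFn_succ, hx]⟩

/-- Under the isomorphism with `2 × 2` matrices, `ρ_s` corresponds to a multiple of the lower one
in the upper left corner. -/
lemma map_rho_succ {q c κ : ℂ} {n : ℕ}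
    (e : Cl (2 * n + 1 + 2) q c ≃ₐ[ℂ] Matrix (Fin 2) (Fin 2) (Cl (2 * n + 1) q c))
    (h0 : e (gen q c 0) = !![0, algebraMap ℂ (Cl (2 * n + 1) q c) κ; 0, 0])
    (hi : ∀ j, e (gen q c (inner j)) = !![-(q ^ 2) • gen q c j, 0; 0, gen q c j])
    (hl : e (gen q c (Fin.last _)) = !![0, 0; 1, 0]) (s : ℂ) :
    e (rho (n + 1) q c s) = !![κ • rho n q c s, 0; 0, 0] := by
  -- Between `E₁₂` and `E₂₁` only lower right entries survive, so the upper left entries `x` and `y`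
  -- need not be known.
  obtain ⟨x, hx⟩ := exists_prod_ofFn_diagonal (-(q ^ 2))
    (fun i : Fin n ↦ gen q c (⟨i, by omega⟩ : Fin (2 * n + 1)))
  obtain ⟨y, hy⟩ := exists_prod_ofFn_diagonal (-(q ^ 2))
    (fun i : Fin n ↦ gen q c (⟨n + 1 + i, by omega⟩ : Fin (2 * n + 1)))
  have hleft : e (List.ofFn fun i : Fin (n + 1) ↦
        gen q c (⟨i, by omega⟩ : Fin (2 * n + 1 + 2))).prod
      = !![0, algebraMap ℂ (Cl (2 * n + 1) q c) κ; 0, 0] * !![x, 0; 0, (List.ofFn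
        fun i : Fin n ↦ gen q c (⟨i, by omega⟩ : Fin (2 * n + 1))).prod] := by
    rw [List.ofFn_succ, List.prod_cons, map_mul, map_list_prod, List.map_ofFn, ← hx]
    refine congrArg₂ _ h0 (congrArg (fun f ↦ (List.ofFn f).prod) (funext fun i ↦ ?_))
    exact hi ⟨i, by omega⟩
  have hright : e (List.ofFn fun i : Fin (n + 1) ↦
        gen q c (⟨n + 1 + 1 + i, by omega⟩ : Fin (2 * n + 1 + 2))).prod
      = !![y, 0; 0, (List.ofFn
        fun i : Fin n ↦ gen q c (⟨n + 1 + i, by omega⟩ : Fin (2 * n + 1))).prod]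
        * !![0, 0; 1, 0] := by
    rw [List.ofFn_succ', List.concat_eq_append, List.prod_append, List.prod_singleton, map_mul,
      map_list_prod, List.map_ofFn, ← hy]
    refine congrArg₂ _ (congrArg (fun f ↦ (List.ofFn f).prod) (funext fun i ↦ ?_)) ?_
    · refine Eq.trans (congrArg (fun k ↦ e (gen q c k)) (Fin.ext ?_)) (hi ⟨n + 1 + i, by omega⟩)
      simp [inner]; omega
    · refine Eq.trans (congrArg (fun k ↦ e (gen q c k)) (Fin.ext ?_)) hl
      simp; omega
  have hmid : e (algebraMap ℂ (Cl (2 * n + 1 + 2) q c) s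
        + gen q c (⟨n + 1, by omega⟩ : Fin (2 * n + 1 + 2)))
      = algebraMap ℂ _ s + !![-(q ^ 2) • gen q c (⟨n, by omega⟩ : Fin (2 * n + 1)), 0;
          0, gen q c (⟨n, by omega⟩ : Fin (2 * n + 1))] := by
    rw [map_add, AlgEquiv.commutes]
    exact congrArg _ (hi ⟨n, by omega⟩)
  have hrho : e (rho (n + 1) q c s) = _ := (map_mul e _ _).trans
    (congrArg₂ (· * ·) ((map_mul e _ _).trans (congrArg₂ (· * ·) hleft hmid)) hright)
  rw [hrho, rho]
  ext i k
  fin_cases i <;> fin_cases k <;>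
    simp [Algebra.algebraMap_eq_smul_one, mul_assoc, mul_add, add_mul]
  rw [smul_comm s κ]

/-- Matrices over a product of two algebras. -/
lemma exists_algEquiv_matrix_prod {R S ι : Type*} [Ring R] [Algebra ℂ R] [Ring S] [Algebra ℂ S]
    [Fintype ι] [DecidableEq ι] :
    ∃ e : Matrix ι ι (R × S) ≃ₐ[ℂ] Matrix ι ι R × Matrix ι ι S,
      ∀ X, e X = (X.map Prod.fst, X.map Prod.snd) := by
  refine ⟨AlgEquiv.ofBijective (((AlgHom.fst ℂ R S).mapMatrix (m := ι)).prod
    ((AlgHom.snd ℂ R S).mapMatrix (m := ι))) ⟨fun X Y h ↦ ?_, fun X ↦ ?_⟩, fun X ↦ rfl⟩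
  · ext i k
    · exact congrFun (congrFun (congrArg Prod.fst h) i) k
    · exact congrFun (congrFun (congrArg Prod.snd h) i) k
  · exact ⟨Matrix.of fun i k ↦ (X.1 i k, X.2 i k), rfl⟩

/-- The single column relation is `1 + q⁻²` times the norm relation. -/
lemma isQClifford_fin_one {A : Type*} [Ring A] [Algebra ℂ A] {q : ℂ} (hq0 : q ≠ 0)
    {z : A} {g : Fin 1 → A} :
    IsQClifford q z g ↔ g 0 * g 0 = (q ^ 2 - 1) • z := by
  have hm : metric 1 q 0 0 = 1 := by simp [metric, twoRho]
  constructor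
  · intro h
    simpa [hm] using h.norm
  · intro h
    refine ⟨fun k l ↦ ?_, by simpa [hm] using h⟩
    obtain rfl := Subsingleton.elim k 0
    obtain rfl := Subsingleton.elim l 0
    simp [colRel, partialNorm, hm, h]
    match_scalars
    field_simp
    ring

/-- `Cl_q(1)` is the product of two copies of `ℂ`, through the two square roots of `c²`. -/
lemma exists_algEquiv_one {q c : ℂ} (hq0 : q ≠ 0) (hq : ∀ m : ℕ, 1 ≤ m → q ^ m ≠ 1) (hc : c ≠ 0) :
    ∃ e : Cl 1 q c ≃ₐ[ℂ] ℂ × ℂ, e (gen q c 0) = (c, -c) := by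
  have h21 : q ^ 2 - 1 ≠ 0 := sub_ne_zero.2 (hq _ (by omega))
  have hg : gen (N := 1) q c 0 * gen q c 0 = algebraMap ℂ _ (c ^ 2) := by
    rw [(isQClifford_fin_one hq0).1 (isQClifford_gen q c hq0 hq le_rfl),
      Algebra.algebraMap_eq_smul_one, Algebra.algebraMap_eq_smul_one, smul_smul,
      mul_div_cancel₀ _ h21]
  have hF : IsQClifford q (algebraMap ℂ (ℂ × ℂ) (c ^ 2 / (q ^ 2 - 1))) (fun _ : Fin 1 ↦ (c, -c)) :=
    (isQClifford_fin_one hq0).2 <| by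
      ext <;> simp <;> field_simp
  let F := liftCl hq0 hq le_rfl hF
  have hF0 : F (gen q c 0) = (c, -c) := liftCl_gen ..
  -- Since `γ² = c²`, the elements `1` and `γ` span; injectivity then reduces to `α ± βc = 0`
  -- forcing `α = β = 0`.
  have hspan (x : Cl 1 q c) : ∃ α β : ℂ, x = algebraMap ℂ _ α + β • gen q c 0 := by
    obtain ⟨x, rfl⟩ := RingQuot.mkAlgHom_surjective ℂ _ x
    induction x using FreeAlgebra.induction with
    | grade0 r => exact ⟨r, 0, by simp⟩
    | grade1 j =>
      obtain rfl := Subsingleton.elim j 0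
      exact ⟨0, 1, by rw [map_zero, zero_add, one_smul]; rfl⟩
    | add x y hx hy =>
      obtain ⟨α, β, hx⟩ := hx
      obtain ⟨α', β', hy⟩ := hy
      exact ⟨α + α', β + β', by rw [map_add, hx, hy, map_add, add_smul]; abel⟩
    | mul x y hx hy =>
      obtain ⟨α, β, hx⟩ := hx
      obtain ⟨α', β', hy⟩ := hy
      refine ⟨α * α' + β * β' * c ^ 2, α * β' + β * α', ?_⟩
      rw [map_mul, hx, hy, mul_add, add_mul, add_mul, smul_mul_smul_comm, hg]
      simp only [Algebra.algebraMap_eq_smul_one, smul_mul_assoc, mul_smul_comm, one_mul, mul_one]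
      module
  refine ⟨AlgEquiv.ofBijective F ⟨?_, ?_⟩, hF0⟩
  · rw [injective_iff_map_eq_zero]
    intro x hx
    obtain ⟨α, β, rfl⟩ := hspan x
    rw [map_add, map_smul, hF0, AlgHom.commutes, Prod.ext_iff] at hx
    obtain ⟨h1, h2⟩ : α + β * c = 0 ∧ α + -(β * c) = 0 := by simpa using hx
    obtain rfl : α = 0 := by linear_combination (h1 + h2) / 2
    obtain rfl : β = 0 := by simpa [hc] using h1
    simp
  · rintro ⟨x, y⟩
    refine ⟨algebraMap ℂ _ ((x + y) / 2) + ((x - y) / (2 * c)) • gen q c 0, ?_⟩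
    rw [map_add, map_smul, hF0, AlgHom.commutes]
    ext <;> simp <;> field_simp <;> ring

/-- `Cl_q(2n+1)` is the product of two copies of a simple algebra, and `ρ_±` are nonzero elements
of the two factors. -/
theorem exists_algEquiv_prod {q c : ℂ} (hq0 : q ≠ 0) (hq : ∀ m : ℕ, 1 ≤ m → q ^ m ≠ 1)
    (hc : c ≠ 0) (n : ℕ) :
    ∃ (R : Type) (_ : Ring R) (_ : Algebra ℂ R) (φ : Cl (2 * n + 1) q c ≃ₐ[ℂ] R × R),
      IsSimpleRing R ∧ FiniteDimensional ℂ R ∧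
      (φ (rho n q c c)).1 ≠ 0 ∧ (φ (rho n q c c)).2 = 0 ∧
      (φ (rho n q c (-c))).1 = 0 ∧ (φ (rho n q c (-c))).2 ≠ 0 := by
  induction n with
  | zero =>
    obtain ⟨e, he⟩ := exists_algEquiv_one hq0 hq hc
    have hrho (s : ℂ) : e (rho 0 q c s) = (s + c, s - c) := by
      have : rho 0 q c s = algebraMap ℂ (Cl 1 q c) s + gen q c 0 := by
        simp [rho]
      rw [this, map_add, AlgEquiv.commutes, he]
      ext <;> simp [sub_eq_add_neg]
    refine ⟨ℂ, inferInstance, inferInstance, e, inferInstance, inferInstance, ?_⟩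
    -- By the formula `(s + c, s - c)`, the images are `(2c, 0)` and `(0, -2c)`.
    change (e (rho 0 q c c)).1 ≠ 0 ∧ (e (rho 0 q c c)).2 = 0 ∧
      (e (rho 0 q c (-c))).1 = 0 ∧ (e (rho 0 q c (-c))).2 ≠ 0
    rw [hrho, hrho]
    have h2 : c + c ≠ 0 := by rw [← two_mul]; exact mul_ne_zero two_ne_zero hc
    have h3 : -c - c ≠ 0 := by rw [← neg_add']; exact neg_ne_zero.2 h2
    exact ⟨h2, sub_self c, neg_add_cancel c, h3⟩
  | succ n ih =>
    obtain ⟨R, _, _, φ, hR, hfd, h1, h2, h3, h4⟩ := ih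
    obtain ⟨e, κ, hκ, h0, hi, hl⟩ := exists_algEquiv_matrix (N := 2 * n + 1) hq0 hq (by omega) hc
    obtain ⟨π, hπ⟩ := exists_algEquiv_matrix_prod (R := R) (S := R) (ι := Fin 2)
    let ψ : Cl (2 * n + 1 + 2) q c ≃ₐ[ℂ] Matrix (Fin 2) (Fin 2) R × Matrix (Fin 2) (Fin 2) R :=
      (e.trans φ.mapMatrix).trans π
    have hψ (s : ℂ) : ψ (rho (n + 1) q c s) = (!![κ • (φ (rho n q c s)).1, 0; 0, 0],
        !![κ • (φ (rho n q c s)).2, 0; 0, 0]) := by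
      change π (φ.mapMatrix (e _)) = _
      rw [map_rho_succ e h0 hi hl, hπ]
      ext i k <;> fin_cases i <;> fin_cases k <;> simp
    have hne {r : R} (hr : r ≠ 0) : !![κ • r, 0; 0, 0] ≠ (0 : Matrix (Fin 2) (Fin 2) R) := by
      intro h
      exact smul_ne_zero hκ hr (congrFun (congrFun h 0) 0)
    have hz {r : R} (hr : r = 0) : !![κ • r, 0; 0, 0] = (0 : Matrix (Fin 2) (Fin 2) R) := by
      ext i k
      fin_cases i <;> fin_cases k <;> simp [hr]
    refine ⟨Matrix (Fin 2) (Fin 2) R, inferInstance, inferInstance, ψ, inferInstance,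
      inferInstance, ?_⟩
    have hp := hψ c
    have hm := hψ (-c)
    exact ⟨by rw [hp]; exact hne h1, by rw [hp]; exact hz h2, by rw [hm]; exact hz h3,
      by rw [hm]; exact hne h4⟩

end Decomposition

end FRTClifford

theorem mainTheorem6 (n : ℕ) (hn : 1 ≤ n) (q : ℂ) (hq0 : q ≠ 0)
    (hq : ∀ m : ℕ, 1 ≤ m → q ^ m ≠ 1) (c : ℂ) (hc : ∃ r : ℝ, r ≠ 0 ∧ c ^ 2 = (r : ℂ)) :
    IsSemisimpleRing (FRTClifford.Cl (2 * n + 1) q c) ∧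
    IsCompl (FRTClifford.toSubspace (FRTClifford.idealPlus n q c))
      (FRTClifford.toSubspace (FRTClifford.idealMinus n q c)) ∧
    FRTClifford.IsSimpleIdeal (FRTClifford.idealPlus n q c) ∧
    FRTClifford.IsSimpleIdeal (FRTClifford.idealMinus n q c) ∧
    FiniteDimensional ℂ (FRTClifford.Cl (2 * n + 1) q c) ∧
    Module.finrank ℂ (FRTClifford.toSubspace (FRTClifford.idealPlus n q c)) =
      Module.finrank ℂ (FRTClifford.toSubspace (FRTClifford.idealMinus n q c)) := by
  have hc0 : c ≠ 0 := by
    rintro rfl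
    obtain ⟨r, hr, h⟩ := hc
    exact hr (by simpa using h.symm)
  obtain ⟨R, _, _, φ, hR, hfd, h1, h2, h3, h4⟩ := FRTClifford.exists_algEquiv_prod hq0 hq hc0 n
  -- With the factors swapped, `ρ_-` plays the role of `ρ_+`. Both ideals are then identified with
  -- the same `R`, which gives equal dimensions.
  let φ' : FRTClifford.Cl (2 * n + 1) q c ≃ₐ[ℂ] R × R :=
    φ.trans (AlgEquiv.ofRingEquiv (f := RingEquiv.prodComm) fun _ ↦ rfl)
  have h3' : (φ' (FRTClifford.rho n q c (-c))).2 = 0 := h3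
  have h4' : (φ' (FRTClifford.rho n q c (-c))).1 ≠ 0 := h4
  have : IsArtinianRing R := IsArtinianRing.of_finite ℂ R
  have : IsSemisimpleRing R := IsSimpleRing.isSemisimpleRing_iff_isArtinianRing.2 inferInstance
  refine ⟨φ.symm.toRingEquiv.isSemisimpleRing, FRTClifford.isCompl_span_singleton φ h1 h2 h3 h4,
    FRTClifford.isSimpleIdeal_span_singleton φ h1 h2,
    FRTClifford.isSimpleIdeal_span_singleton φ' h4' h3',
    Module.Finite.equiv φ.symm.toLinearEquiv, ?_⟩
  exact (FRTClifford.finrank_span_singleton φ h1 h2).trans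
    (FRTClifford.finrank_span_singleton φ' h4' h3').symm
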